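/- For $m\ge 0$ let $\mathcal F_m=\{(z_1,\dots,z_m)\in\mathbb C^m : z_i\ne z_j \text{ for } i\ne j\}$ and let $\mathcal C_m=\mathcal F_m/\Sigma_m$ be its quotient by the symmetric group (with the quotient topology), with projection $p:\mathcal F_m\to\mathcal C_m$. A point $\{z_1,\dots,z_m\}$ of $\mathcal C_m$ is identified, up to a nonzero scalar, with the polynomial $\prod_i(X-z_i)$. Let $n\ge 1$ and put $$Q\mathcal F_{n-1}=\Big\{(\beta_1,\dots,\beta_{n-1})\in\mathcal F_{n-1} : \int_{\beta_k}^{\beta_j} Q(t)\,dt\ne 0 \text{ for all } k\ne j\Big\},\qquad Q(X)=n\prod_{i=1}^{n-1}(X-\beta_i),$$ $$Q\mathcal C_{n-1}=p(Q\mathcal F_{n-1})=Q\mathcal F_{n-1}/\Sigma_{n-1}\subseteq\mathcal C_{n-1}.$$ Let $R\mathcal C_n\subseteq\mathcal C_n$ be the set of those $\{\alpha_1,\dots,\alpha_n\}$ for which the derivative of $\prod_{i=1}^n(X-\alpha_i)$ equals $n\prod_{i=1}^{n-1}(X-\beta_i)$ for some $\{\beta_1,\dots,\beta_{n-1}\}\in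 Q\mathcal C_{n-1}$, and let $R\mathcal F_n=p^{-1}(R\mathcal C_n)\subseteq\mathcal F_n$. All these subsets carry the subspace topology. **Proposition.** The four spaces $Q\mathcal F_{n-1}$, $Q\mathcal C_{n-1}$, $R\mathcal F_n$, $R\mathcal C_n$ are (nonempty and) path-connected, and, for every choice of base point, the homomorphisms induced by the inclusions $$Q\mathcal P_{n-1}=\pi_1(Q\mathcal F_{n-1})\to\pi_1(\mathcal F_{n-1})=\mathcal P_{n-1},\qquad Q\mathcal B_{n-1}=\pi_1(Q\mathcal C_{n-1})\to\pi_1(\mathcal C_{n-1})=\mathcal B_{n-1},$$ $$R\mathcal P_n=\pi_1(R\mathcal F_n)\to\pi_1(\mathcal F_n)=\mathcal P_n,\qquad R\mathcal B_n=\pi_1(R\mathcal C_n)\to\pi_1(\mathcal C_n)=\mathcal B_n$$ are all surjective. -/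

import Mathlib

open Polynomial

noncomputable section

/-- The ordered configuration space `F_n` of `n` distinct points of `ℂ`,
a subspace of `ℂ ^ n`. -/
abbrev OrderedConf (n : ℕ) : Type := {z : Fin n → ℂ // Function.Injective z}

/-- The symmetric group permutes the coordinates of an ordered configuration. -/
instance OrderedConf.instMulAction (n : ℕ) :
    MulAction (Equiv.Perm (Fin n)) (OrderedConf n) where
  smul σ z := ⟨fun i => z.1 (σ⁻¹ i), z.2.comp (σ⁻¹).injective⟩
  one_smul _ := rfl
  mul_smul σ τ z := Subtype.ext (funext fun i => by
    change z.1 ((σ * τ)⁻¹ i) = z.1 (τ⁻¹ (σ⁻¹ i))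
    rw [mul_inv_rev, Equiv.Perm.mul_apply])

/-- The unordered configuration space `C_n = F_n / Σ_n`, with the quotient topology. -/
abbrev UnorderedConf (n : ℕ) : Type :=
  MulAction.orbitRel.Quotient (Equiv.Perm (Fin n)) (OrderedConf n)

/-- The projection `p : F_n → C_n`. -/
def confProj (n : ℕ) (z : OrderedConf n) : UnorderedConf n := Quotient.mk _ z

/-- The monic polynomial `∏ (X - z_i)` of an ordered configuration. -/
def orderedPoly {n : ℕ} (z : OrderedConf n) : ℂ[X] := ∏ i, (X - C (z.1 i))

theorem orderedPoly_smul {n : ℕ} (σ : Equiv.Perm (Fin n)) (z : OrderedConf n) :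
    orderedPoly (σ • z) = orderedPoly z :=
  Equiv.prod_comp (σ⁻¹) (fun i => X - C (z.1 i))

/-- The monic polynomial with simple roots corresponding to an unordered configuration. -/
def unorderedPoly {n : ℕ} (c : UnorderedConf n) : ℂ[X] :=
  Quotient.lift orderedPoly (by
    rintro _ w ⟨σ, rfl⟩
    exact orderedPoly_smul σ w) c

/-- The integral `∫_a^b q(t) dt` of a complex polynomial along the segment from `a` to `b`
(for a polynomial, the value does not depend on the path from `a` to `b`). -/
def polyIntegral (q : ℂ[X]) (a b : ℂ) : ℂ :=
  ∫ t in (0 : ℝ)..1, q.eval (a + (t : ℂ) * (b - a)) * (b - a)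

theorem polyIntegral_derivative (P : ℂ[X]) (a b : ℂ) :
    polyIntegral (derivative P) a b = P.eval b - P.eval a := by
  have hd : ∀ t : ℝ, HasDerivAt (fun t : ℝ => P.eval (a + (t : ℂ) * (b - a)))
      ((derivative P).eval (a + (t : ℂ) * (b - a)) * (b - a)) t := by
    intro t
    have h1 : HasDerivAt (fun t : ℝ => a + (t : ℂ) * (b - a)) (b - a) t := by
      simpa using ((Complex.ofRealCLM.hasDerivAt (x := t)).mul_const (b - a)).const_add a
    exact (P.hasDerivAt _).comp t h1
  have hc : Continuous fun t : ℝ =>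
      (derivative P).eval (a + (t : ℂ) * (b - a)) * (b - a) := by fun_prop
  have h := intervalIntegral.integral_eq_sub_of_hasDerivAt (a := 0) (b := 1)
    (fun t _ => hd t) (hc.intervalIntegrable 0 1)
  simpa [polyIntegral] using h

/-- The restricted ordered base configuration space `QF_m ⊆ F_m`: the configurations
`β` such that, for `Q(X) = (m + 1) ∏ (X - β_i)`, all the integrals `∫_{β_k}^{β_j} Q(t) dt`,
`k ≠ j`, are nonzero. -/
def QF (m : ℕ) : Set (OrderedConf m) :=
  {β | ∀ k j : Fin m, k ≠ j →
    polyIntegral (C ((m : ℂ) + 1) * orderedPoly β) (β.1 k) (β.1 j) ≠ 0}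

/-- The restricted unordered base configuration space `QC_m = QF_m / Σ_m`,
as a subspace of `C_m`. -/
def QC (m : ℕ) : Set (UnorderedConf m) := confProj m '' QF m

/-- The restricted configuration space `RC_n = C_n ∩ D⁻¹(QC_{n-1})`, `n ≥ 1`, where `D` is the
derivative of polynomials and `b ∈ QC_{n-1}` stands for the polynomial `n ∏ (X - b_i)`. -/
def RC (n : ℕ) : Set (UnorderedConf n) :=
  {c | ∃ b ∈ QC (n - 1), derivative (unorderedPoly c) = C (n : ℂ) * unorderedPoly b}

/-- The restricted ordered configuration space `RF_n = p⁻¹(RC_n)`. -/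
def RF (n : ℕ) : Set (OrderedConf n) := confProj n ⁻¹' RC n

/-- The homomorphism `π₁(S, x) → π₁(Y, x)` induced by the inclusion of a subspace `S ⊆ Y`. -/
def inclusionHom {Y : Type*} [TopologicalSpace Y] (S : Set Y) (x : S) :
    FundamentalGroup S x →* FundamentalGroup Y (x : Y) :=
  FundamentalGroup.map (⟨Subtype.val, continuous_subtype_val⟩ : C(S, Y)) x

end

/-!
Each of the four spaces is the complement of a complex hypersurface in a configuration space. Such a
hypersurface has real codimension two: removing it neither disconnects a connected open set nor
loses a class of its fundamental group.

The hypersurfaces enter only through a weak property. A subset `S` of a complex vector space is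
called thin (`IsThin`) if every complex line not contained in `S` meets `S` in countably many
points. Inside the complex line through two points of a ball, a generic one among the arcs `t ↦ t +
i s t (1 - t)`, pairwise disjoint up to their end points, joins the two points while avoiding `S`
(`IsThin.exists_arc`). Applied to the small pieces of a path with end points outside `S`, this
approximates the path uniformly by paths avoiding `S`; in an open set, a close approximation is
homotopic to the path by the straight-line homotopy (`IsThin.exists_homotopic_path`). This settles
subspaces of `F_n`. A loop in `C_n` lifts along the covering `F_n → C_n` to a path in `F_n`, which
is pushed off `S` in the same way and projected back (`pathConnected_and_surjective_of_isThin`).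

It remains to see that the excluded sets are thin, that is, that along each line `a + t v` the
defining condition is the nonvanishing of a polynomial in `t`. For `QF` this holds because
polynomials with coefficients in `ℂ[t]` have antiderivatives (`isThin_polyIntegral_eq_zero`). For
`RF` the condition says that `P = ∏ (X - α_i)` has distinct values at the roots `β_j` of its
derivative. The product of the differences `P(β_j) - P(β_k)` is symmetric in the `β_j`, hence by the
fundamental theorem on symmetric polynomials a polynomial in the coefficients of `P'`, and so in `t`
(`exists_eq_valueDiffProd_roots`, `isThin_not_hasDistinctCriticalValues`). The spaces are nonempty
because `X ^ (m + 1) - m (m + 1) X` has simple roots and distinct critical values.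
-/

/-! ### Thin sets and paths avoiding them -/

/-- A set `S` in a complex vector space is thin if every complex line that is not contained in `S`
meets `S` in countably many points. -/
def IsThin {E : Type*} [AddCommGroup E] [Module ℂ E] (S : Set E) : Prop :=
  ∀ a ∉ S, ∀ v : E, {t : ℂ | a + t • v ∈ S}.Countable

theorem IsThin.union {E : Type*} [AddCommGroup E] [Module ℂ E] {S T : Set E}
    (hS : IsThin S) (hT : IsThin T) : IsThin (S ∪ T) := by
  intro a ha v
  rw [Set.mem_union, not_or] at ha
  exact (hS a ha.1 v).union (hT a ha.2 v)

section Paths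

variable {E : Type*} [NormedAddCommGroup E] [NormedSpace ℂ E]

/-- Two points of a ball outside a thin set are joined, inside the complex line through them,
by an arc that stays in the ball and avoids the thin set. -/
theorem IsThin.exists_arc {S : Set E} (hS : IsThin S) {a b c : E} {r : ℝ} (ha : a ∉ S)
    (hb : b ∉ S) (har : dist a c < r) (hbr : dist b c < r) :
    ∃ f : ℝ → E, Continuous f ∧ f 0 = a ∧ f 1 = b ∧ (∀ t, f t ∉ S) ∧
      ∀ t ∈ Set.Icc (0 : ℝ) 1, dist (f t) c < r := by
  have hT := hS a ha (b - a)
  set T := {t : ℂ | a + t • (b - a) ∈ S}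
  -- Through each parameter in `T` there passes at most one of the arcs
  -- `t ↦ t + i s t (1 - t)`, so a small `s` outside a countable set gives an arc avoiding `T`.
  set m := max (dist a c) (dist b c) with hm
  have hmr : m < r := max_lt har hbr
  set δ := (r - m) / (‖b - a‖ + 1) with hδ
  have hδ0 : 0 < δ := div_pos (sub_pos.2 hmr) (by positivity)
  have hδ1 : δ * ‖b - a‖ < r - m := by
    have h1 : δ * (‖b - a‖ + 1) = r - m := by rw [hδ]; field_simp
    nlinarith
  have hbad : ((fun τ : ℂ => τ.im / (τ.re * (1 - τ.re))) '' T).Countable := hT.image _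
  obtain ⟨s, hs, hsT⟩ :
      (Set.Ioo 0 δ ∩ ((fun τ : ℂ => τ.im / (τ.re * (1 - τ.re))) '' T)ᶜ).Nonempty :=
    (hbad.dense_compl ℝ).inter_open_nonempty _ isOpen_Ioo (Set.nonempty_Ioo.2 hδ0)
  set g : ℝ → ℂ := fun t => ⟨t, s * (t * (1 - t))⟩ with hg
  have hgc : Continuous g := by
    have : g = fun t : ℝ => (t : ℂ) + ((s * (t * (1 - t)) : ℝ) : ℂ) * Complex.I := by
      funext t
      apply Complex.ext <;> simp [hg]
    rw [this]; fun_prop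
  have hg0 : g 0 = 0 := by apply Complex.ext <;> simp [hg]
  have hg1 : g 1 = 1 := by apply Complex.ext <;> simp [hg]
  refine ⟨fun t => a + g t • (b - a), by fun_prop, by simp [hg0], by simp [hg1], ?_, ?_⟩
  · intro t ht
    by_cases h0 : t * (1 - t) = 0
    · rcases mul_eq_zero.1 h0 with h | h
      · subst h; simp [hg0] at ht; exact ha ht
      · have : t = 1 := by linarith
        subst this; simp [hg1] at ht; exact hb ht
    · apply hsT
      refine ⟨g t, ht, ?_⟩
      simp only [hg]
      exact mul_div_cancel_right₀ s h0
  · intro t ht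
    have h1 : a + g t • (b - a) - c =
        ((1 - t : ℝ) : ℂ) • (a - c) + (t : ℂ) • (b - c) +
          (((s * (t * (1 - t)) : ℝ) : ℂ) * Complex.I) • (b - a) := by
      have : g t = (t : ℂ) + ((s * (t * (1 - t)) : ℝ) : ℂ) * Complex.I := by
        apply Complex.ext <;> simp [hg]
      rw [this]; push_cast; module
    have ht0 := ht.1
    have ht1 := ht.2
    rw [dist_eq_norm, h1]
    have ha' : ‖a - c‖ ≤ m := by rw [← dist_eq_norm]; exact le_max_left _ _
    have hb' : ‖b - c‖ ≤ m := by rw [← dist_eq_norm]; exact le_max_right _ _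
    have hn : ‖((s * (t * (1 - t)) : ℝ) : ℂ) * Complex.I‖ ≤ δ := by
      rw [norm_mul, Complex.norm_I, mul_one, Complex.norm_real, Real.norm_eq_abs,
        abs_of_nonneg (mul_nonneg hs.1.le (mul_nonneg ht0 (by linarith)))]
      have : t * (1 - t) ≤ 1 := by nlinarith [sq_nonneg t]
      nlinarith [hs.1, hs.2]
    calc _ ≤ ‖((1 - t : ℝ) : ℂ) • (a - c)‖ + ‖(t : ℂ) • (b - c)‖ +
          ‖(((s * (t * (1 - t)) : ℝ) : ℂ) * Complex.I) • (b - a)‖ := norm_add₃_le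
      _ ≤ (1 - t) * m + t * m + δ * ‖b - a‖ := by
          rw [norm_smul, norm_smul, norm_smul, Complex.norm_real, Complex.norm_real,
            Real.norm_of_nonneg ht0, Real.norm_of_nonneg (sub_nonneg.2 ht1)]
          gcongr
      _ < r := by linarith

/-- The complement of a thin set is dense, unless it is empty. -/
theorem IsThin.exists_dist_lt {S : Set E} (hS : IsThin S) {a : E} (ha : a ∉ S) (x : E) {r : ℝ}
    (hr : 0 < r) : ∃ u ∉ S, dist u x < r := by
  have hT := hS a ha (x - a)
  have hc : Continuous fun t : ℂ => a + t • (x - a) := by fun_prop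
  obtain ⟨t, ht, htS⟩ := (hT.dense_compl ℝ).inter_open_nonempty
    ((fun t : ℂ => a + t • (x - a)) ⁻¹' Metric.ball x r) (Metric.isOpen_ball.preimage hc)
    ⟨1, by simpa using hr⟩
  exact ⟨_, htS, ht⟩

/-- A path whose end points lie outside a thin set is uniformly approximated, with fixed end
points, by paths avoiding the thin set. -/
theorem IsThin.exists_near_path {S : Set E} (hS : IsThin S) {x y : E} (hx : x ∉ S) (hy : y ∉ S)
    (γ : Path x y) {ε : ℝ} (hε : 0 < ε) :
    ∃ δ : Path x y, (∀ t, δ t ∉ S) ∧ ∀ t, dist (δ t) (γ t) < ε := by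
  obtain ⟨η, hη, hγ⟩ := Metric.uniformContinuous_iff.1
    (CompactSpace.uniformContinuous_of_continuous γ.continuous) (ε / 3) (by positivity)
  obtain ⟨N, hN⟩ := exists_nat_one_div_lt hη
  set n : ℝ := (N : ℝ) + 1 with hn
  have hn0 : 0 < n := by positivity
  have hγ' : ∀ s ∈ Set.Icc (0 : ℝ) 1, ∀ t ∈ Set.Icc (0 : ℝ) 1, |s - t| ≤ 1 / n →
      dist (γ.extend s) (γ.extend t) < ε / 3 := by
    intro s hs t ht hst
    rw [Path.extend_apply _ hs, Path.extend_apply _ ht]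
    exact hγ (lt_of_le_of_lt hst hN)
  -- The approximation is built on `[0, k / n]`, with an arbitrary end point close to `γ (k / n)`.
  have key : ∀ k : ℕ, (k : ℝ) ≤ n → ∀ u ∉ S, dist u (γ.extend (k / n)) < ε / 3 → (k = 0 → u = x) →
      ∃ f : ℝ → E, Continuous f ∧ f 0 = x ∧ f (k / n) = u ∧
        ∀ t ∈ Set.Icc (0 : ℝ) (k / n), f t ∉ S ∧ dist (f t) (γ.extend t) < ε := by
    intro k
    induction k with
    | zero =>
      intro _ u hu _ hux
      obtain rfl := hux rfl
      refine ⟨fun _ => u, continuous_const, rfl, rfl, fun t ht => ⟨hu, ?_⟩⟩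
      obtain rfl : t = 0 := by simpa using ht
      simpa using hε
    | succ k ih =>
      intro hk u' hu' hud' _
      push_cast at hk hud' ⊢
      have hkn : (k : ℝ) / n ∈ Set.Icc (0 : ℝ) 1 :=
        ⟨by positivity, (div_le_one hn0).2 (by linarith)⟩
      have hkn' : ((k : ℝ) + 1) / n ∈ Set.Icc (0 : ℝ) 1 :=
        ⟨by positivity, (div_le_one hn0).2 hk⟩
      have hsub : ((k : ℝ) + 1) / n = k / n + 1 / n := add_div _ _ _
      obtain ⟨u, hu, hud, hux⟩ : ∃ u ∉ S, dist u (γ.extend (k / n)) < ε / 3 ∧ (k = 0 → u = x) := by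
        rcases Nat.eq_zero_or_pos k with rfl | h
        · exact ⟨x, hx, by simpa using by positivity, fun _ => rfl⟩
        · obtain ⟨u, hu, h1⟩ := hS.exists_dist_lt hx (γ.extend (k / n))
            (show 0 < ε / 3 by positivity)
          exact ⟨u, hu, h1, fun h2 => absurd h2 h.ne'⟩
      obtain ⟨f, hf, hf0, hf1, hfS⟩ := ih (by linarith) u hu hud hux
      have hstep : dist (γ.extend ((k + 1) / n)) (γ.extend (k / n)) < ε / 3 :=
        hγ' _ hkn' _ hkn (by rw [hsub, add_sub_cancel_left, abs_of_pos (by positivity)])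
      obtain ⟨e, he, he0, he1, heS, hed⟩ := hS.exists_arc (c := γ.extend (k / n))
        (r := 2 * ε / 3) hu hu' (by linarith)
        (by linarith [dist_triangle u' (γ.extend ((k + 1) / n)) (γ.extend (k / n))])
      refine ⟨fun τ => if τ ≤ k / n then f τ else e (n * τ - k), ?_, ?_, ?_, ?_⟩
      · refine Continuous.if_le hf (by fun_prop) continuous_id continuous_const ?_
        rintro τ rfl
        rw [hf1, mul_div_cancel₀ _ hn0.ne', sub_self, he0]
      · simp [hkn.1, hf0]
      · have : ¬ ((k : ℝ) + 1) / n ≤ k / n := by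
          rw [hsub, not_le]; exact lt_add_of_pos_right _ (by positivity)
        simp only [this, if_false]
        rw [mul_div_cancel₀ _ hn0.ne', add_sub_cancel_left, he1]
      · intro t ht
        by_cases h : t ≤ k / n
        · simp only [h, if_true]
          exact hfS t ⟨ht.1, h⟩
        · simp only [h, if_false]
          refine ⟨heS _, ?_⟩
          rw [not_le] at h
          have h1 : (k : ℝ) < n * t := by rwa [div_lt_iff₀' hn0] at h
          have h2 : n * t ≤ k + 1 := by have := ht.2; rwa [le_div_iff₀' hn0] at this
          have h3 := hed (n * t - k) ⟨by linarith, by linarith⟩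
          have h4 : dist (γ.extend (k / n)) (γ.extend t) < ε / 3 := by
            refine hγ' _ hkn _ ⟨ht.1, ht.2.trans hkn'.2⟩ ?_
            rw [abs_sub_comm, abs_of_pos (sub_pos.2 h)]
            linarith [ht.2]
          linarith [dist_triangle (e (n * t - k)) (γ.extend (k / n)) (γ.extend t)]
  obtain ⟨f, hf, hf0, hf1, hfS⟩ := key (N + 1) (by simp [hn]) y hy (by
    have : ((N + 1 : ℕ) : ℝ) / n = 1 := by rw [hn]; push_cast; field_simp
    rw [this]; simpa using by positivity) (by simp)
  have h1 : ((N + 1 : ℕ) : ℝ) / n = 1 := by rw [hn]; push_cast; field_simp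
  rw [h1] at hf1 hfS
  refine ⟨⟨⟨fun t => f t, by fun_prop⟩, by simpa using hf0, by simpa using hf1⟩, ?_, ?_⟩
  · intro t
    exact (hfS t t.2).1
  · intro t
    have := (hfS t t.2).2
    rwa [Path.extend_apply _ t.2] at this

/-- In an open subset of a complex normed space, every path with end points outside a thin set is
homotopic, with fixed end points, to a path avoiding the thin set. -/
theorem IsThin.exists_homotopic_path {S : Set E} (hS : IsThin S) {p : E → Prop}
    (hp : IsOpen {z | p z}) {x y : {z // p z}} (hx : x.1 ∉ S) (hy : y.1 ∉ S) (γ : Path x y) :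
    ∃ δ : Path x y, δ.Homotopic γ ∧ ∀ t, (δ t).1 ∉ S := by
  let γ' : Path x.1 y.1 := γ.map continuous_subtype_val
  obtain ⟨ε, hε, hεp⟩ := (isCompact_range γ'.continuous).exists_thickening_subset_open hp (by
    rintro _ ⟨t, rfl⟩
    exact (γ t).2)
  obtain ⟨δ, hδS, hδ⟩ := hS.exists_near_path hx hy γ' hε
  -- The straight-line homotopy from `δ` to `γ` stays within distance `ε` of the path `γ`.
  have hline : ∀ s t : unitInterval, p (AffineMap.lineMap (δ t) (γ' t) (s : ℝ)) := by
    intro s t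
    refine hεp (Metric.mem_thickening_iff.2 ⟨γ' t, ⟨t, rfl⟩, ?_⟩)
    rw [dist_lineMap_right, Real.norm_of_nonneg (sub_nonneg.2 s.2.2)]
    nlinarith [hδ t, s.2.1, s.2.2, dist_nonneg (x := δ t) (y := γ' t)]
  have hδp : ∀ t, p (δ t) := fun t => by simpa using hline 0 t
  refine ⟨⟨⟨fun t => ⟨δ t, hδp t⟩, by fun_prop⟩, Subtype.ext δ.source, Subtype.ext δ.target⟩,
    ⟨⟨⟨⟨fun q => ⟨AffineMap.lineMap (δ q.2) (γ' q.2) (q.1 : ℝ), hline q.1 q.2⟩, ?_⟩, ?_, ?_⟩, ?_⟩⟩,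
    hδS⟩
  · refine Continuous.subtype_mk ?_ _
    simp only [AffineMap.lineMap_apply_module]
    fun_prop
  · intro t
    exact Subtype.ext (by simp)
  · intro t
    exact Subtype.ext (by simp [γ'])
  · rintro s t (rfl | rfl)
    · exact Subtype.ext (by simp [γ'])
    · exact Subtype.ext (by simp [γ'])

end Paths

/-! ### Polynomial conditions define thin sets -/

/-- A set is thin as soon as, on each line through a point `a` outside of it, it is contained in
the zero set of a polynomial not vanishing at `a`. -/
theorem IsThin.of_polynomial {E : Type*} [AddCommGroup E] [Module ℂ E] {S : Set E}
    (h : ∀ a ∉ S, ∀ v : E, ∃ q : ℂ[X], q.eval 0 ≠ 0 ∧ ∀ t : ℂ, a + t • v ∈ S → q.eval t = 0) :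
    IsThin S := by
  intro a ha v
  obtain ⟨q, hq0, hq⟩ := h a ha v
  have hq' : q ≠ 0 := by rintro rfl; simp at hq0
  refine (q.rootSet_finite ℂ).countable.mono fun t ht => ?_
  rw [Polynomial.mem_rootSet]
  exact ⟨hq', by simpa using hq t ht⟩

/-- The product of the differences `P(x_j) - P(x_k)`, `k ≠ j`. -/
noncomputable def valueDiffProd {R : Type*} [CommRing R] {m : ℕ} (P : R[X]) (x : Fin m → R) : R :=
  ∏ k, ∏ j ∈ Finset.univ.erase k, (P.eval (x j) - P.eval (x k))

theorem valueDiffProd_ne_zero_iff {R : Type*} [CommRing R] [IsDomain R] {m : ℕ} {P : R[X]}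
    {x : Fin m → R} : valueDiffProd P x ≠ 0 ↔ ∀ k j, k ≠ j → P.eval (x j) - P.eval (x k) ≠ 0 := by
  simp only [valueDiffProd, Finset.prod_ne_zero_iff, Finset.mem_erase, Finset.mem_univ, and_true,
    true_implies]
  exact ⟨fun h k j hkj => h k j hkj.symm, fun h k j hkj => h k j hkj.symm⟩

theorem map_valueDiffProd {R R' : Type*} [CommRing R] [CommRing R'] (φ : R →+* R') {m : ℕ}
    (P : R[X]) (x : Fin m → R) :
    φ (valueDiffProd P x) = valueDiffProd (P.map φ) fun i => φ (x i) := by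
  simp [valueDiffProd, map_prod, Polynomial.eval_map_apply]

theorem exists_derivative_eq {R : Type*} [CommRing R] [Algebra ℚ R] (q : R[X]) :
    ∃ P : R[X], derivative P = q := by
  induction q using Polynomial.induction_on' with
  | add p q hp hq =>
    obtain ⟨P, rfl⟩ := hp
    obtain ⟨Q, rfl⟩ := hq
    exact ⟨P + Q, derivative_add⟩
  | monomial n a =>
    refine ⟨monomial (n + 1) (((n : ℚ) + 1)⁻¹ • a), ?_⟩
    rw [derivative_monomial, Nat.add_sub_cancel, smul_mul_assoc]
    congr 1
    have : a * ((n + 1 : ℕ) : R) = ((n : ℚ) + 1) • a := by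
      rw [Algebra.smul_def]; push_cast; simp [mul_comm]
    rw [this, smul_smul, inv_mul_cancel₀ (by positivity), one_smul]

/-- The coordinates of the complex line `t ↦ a + t v`, as polynomials in `t`. -/
noncomputable def lineCoord {m : ℕ} (a v : Fin m → ℂ) (i : Fin m) : ℂ[X] := C (a i) + X * C (v i)

theorem eval_lineCoord {m : ℕ} (a v : Fin m → ℂ) (i : Fin m) (t : ℂ) :
    evalRingHom t (lineCoord a v i) = (a + t • v) i := by
  simp [lineCoord, mul_comm t]

theorem isThin_not_injective (m : ℕ) : IsThin {z : Fin m → ℂ | ¬ Function.Injective z} := by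
  have key : ∀ z : Fin m → ℂ, valueDiffProd X z ≠ 0 ↔ Function.Injective z := by
    intro z
    rw [valueDiffProd_ne_zero_iff]
    simp only [eval_X, sub_ne_zero]
    exact ⟨fun h k j hkj => by_contra fun hne => h k j hne hkj.symm,
      fun h k j hkj hz => hkj (h hz.symm)⟩
  refine IsThin.of_polynomial fun a ha v => ⟨valueDiffProd X (lineCoord a v), ?_, fun t ht => ?_⟩
  · rw [← coe_evalRingHom, map_valueDiffProd]
    simp only [eval_lineCoord, map_X, zero_smul, add_zero]
    rwa [key, ← not_not (a := Function.Injective a)]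
  · rw [← coe_evalRingHom, map_valueDiffProd]
    simp only [eval_lineCoord, map_X]
    exact not_not.1 fun h => ht ((key _).1 h)

/-- The points of `ℂ ^ m` violating the condition that defines `QF m` form a thin set. -/
theorem isThin_polyIntegral_eq_zero (m : ℕ) :
    IsThin {β : Fin m → ℂ | ¬ ∀ k j : Fin m, k ≠ j →
      polyIntegral (C ((m : ℂ) + 1) * ∏ i, (X - C (β i))) (β k) (β j) ≠ 0} := by
  refine IsThin.of_polynomial fun a ha v => ?_
  obtain ⟨P, hP⟩ := exists_derivative_eq
    (C (C ((m : ℂ) + 1)) * ∏ i, (X - C (lineCoord a v i)) : ℂ[X][X])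
  have hPt : ∀ t : ℂ, derivative (P.map (evalRingHom t)) =
      C ((m : ℂ) + 1) * ∏ i, (X - C ((a + t • v) i)) := by
    intro t
    rw [derivative_map, hP]
    simp only [Polynomial.map_mul, Polynomial.map_prod, Polynomial.map_sub, map_X, map_C,
      eval_lineCoord]
    simp
  have key : ∀ t : ℂ, (valueDiffProd P (lineCoord a v)).eval t ≠ 0 ↔ ∀ k j : Fin m, k ≠ j →
      polyIntegral (C ((m : ℂ) + 1) * ∏ i, (X - C ((a + t • v) i)))
        ((a + t • v) k) ((a + t • v) j) ≠ 0 := by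
    intro t
    rw [← coe_evalRingHom, map_valueDiffProd, valueDiffProd_ne_zero_iff, ← hPt]
    simp only [eval_lineCoord, polyIntegral_derivative]
  refine ⟨valueDiffProd P (lineCoord a v), ?_, fun t ht => ?_⟩
  · rw [key]
    simpa using ha
  · exact not_not.1 fun h => ht ((key t).1 h)

/-- For polynomials `P` and `D` over a ring of parameters `R`, the product of the differences of
the values of `P` at the roots of `D` is itself given by an element of `R`, whenever a
specialization of the parameters makes `D` a product of `m` monic linear factors. It is a symmetric
function of the roots, hence a polynomial in the coefficients of `D`. -/
theorem exists_eq_valueDiffProd_roots {R : Type*} [CommRing R] (K : Type*) [CommRing K] {m : ℕ}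
    (P D : R[X]) : ∃ q : R, ∀ (φ : R →+* K) (β : Fin m → K),
      D.map φ = ∏ i, (X - C (β i)) → φ q = valueDiffProd (P.map φ) β := by
  let G : MvPolynomial (Fin m) R := valueDiffProd (P.map MvPolynomial.C) MvPolynomial.X
  have hG : G.IsSymmetric := by
    intro σ
    have : (MvPolynomial.rename σ : MvPolynomial (Fin m) R →ₐ[R] MvPolynomial (Fin m) R) G =
        valueDiffProd (P.map MvPolynomial.C) fun i => MvPolynomial.X (σ i) := by
      have h := map_valueDiffProd
        (MvPolynomial.rename σ : MvPolynomial (Fin m) R →ₐ[R] MvPolynomial (Fin m) R).toRingHom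
        (P.map MvPolynomial.C) MvPolynomial.X
      rw [Polynomial.map_map] at h
      have hc : (MvPolynomial.rename σ : MvPolynomial (Fin m) R →ₐ[R] _).toRingHom.comp
          MvPolynomial.C = MvPolynomial.C := by ext r : 1; simp
      rw [hc] at h
      simpa using h
    rw [this]
    simp only [G, valueDiffProd]
    refine Eq.trans ?_ (Equiv.prod_comp σ fun k => ∏ j ∈ Finset.univ.erase k,
      ((P.map MvPolynomial.C).eval (MvPolynomial.X j) -
        (P.map MvPolynomial.C).eval (MvPolynomial.X k)))
    refine Finset.prod_congr rfl fun k _ => ?_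
    refine Finset.prod_bij (fun j _ => σ j) (fun j hj => by simpa using hj)
      (fun i _ j _ h => σ.injective h) (fun j hj => ?_) fun j _ => rfl
    exact ⟨σ.symm j, by simpa [Equiv.symm_apply_eq] using hj, by simp⟩
  obtain ⟨H, hH⟩ := MvPolynomial.esymmAlgHom_fin_surjective R (le_refl m) ⟨G, hG⟩
  have hH' : MvPolynomial.aeval (fun i : Fin m => MvPolynomial.esymm (Fin m) R (i + 1)) H = G := by
    rw [← MvPolynomial.esymmAlgHom_apply, hH]
  refine ⟨MvPolynomial.aeval
    (fun i : Fin m => (-1) ^ ((i : ℕ) + 1) * D.coeff (m - ((i : ℕ) + 1))) H, ?_⟩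
  intro φ β hD
  have hev : MvPolynomial.eval₂Hom φ β G = valueDiffProd (P.map φ) β := by
    simp only [G]
    rw [map_valueDiffProd, Polynomial.map_map]
    congr 2
    · ext r : 1; simp
    · funext i; simp
  rw [← hev, ← hH', MvPolynomial.aeval_def, MvPolynomial.aeval_def, MvPolynomial.hom_eval₂,
    MvPolynomial.hom_eval₂]
  have h1 : φ.comp (algebraMap R R) = φ := by ext r : 1; simp
  have h2 : (MvPolynomial.eval₂Hom φ β).comp (algebraMap R (MvPolynomial (Fin m) R)) = φ := by
    ext r : 1; simp [MvPolynomial.algebraMap_eq]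
  rw [h1, h2]
  congr 1
  funext i
  have h3 := congrArg (fun p => coeff p (m - ((i : ℕ) + 1))) hD
  have hi : (i : ℕ) + 1 ≤ m := i.2
  have h4 := Multiset.prod_X_sub_C_coeff (Finset.univ.val.map β) (k := m - ((i : ℕ) + 1)) (by simp)
  simp only [Multiset.map_map, Multiset.card_map, Finset.card_val, Finset.card_univ,
    Fintype.card_fin, Nat.sub_sub_self hi] at h4
  have h5 : (∏ i, (X - C (β i))).coeff (m - ((i : ℕ) + 1)) =
    (-1) ^ ((i : ℕ) + 1) * (Finset.univ.val.map β).esymm ((i : ℕ) + 1) := h4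
  simp only [coeff_map] at h3
  rw [map_mul, h3, h5, map_pow, map_neg, map_one, ← mul_assoc, ← mul_pow]
  simp only [neg_mul_neg, one_mul, one_pow]
  let := φ.toAlgebra
  exact (MvPolynomial.aeval_esymm_eq_multiset_esymm (Fin m) R ((i : ℕ) + 1) β).symm

theorem exists_eq_prod_X_sub_C {K : Type*} [Field K] [IsAlgClosed K] {p : K[X]} {m : ℕ}
    (hp : p.Monic) (hm : p.natDegree = m) : ∃ β : Fin m → K, p = ∏ i, (X - C (β i)) := by
  have hs := IsAlgClosed.splits p
  have hcard : p.roots.toList.length = m := by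
    rw [Multiset.length_toList, ← hm, hs.natDegree_eq_card_roots]
  subst hcard
  refine ⟨p.roots.toList.get, ?_⟩
  conv_lhs => rw [hs.eq_prod_roots_of_monic hp, ← Multiset.coe_toList p.roots]
  rw [Multiset.map_coe, Multiset.prod_coe, ← List.prod_ofFn]
  congr 1
  conv_lhs => rw [← List.ofFn_get p.roots.toList]
  rw [List.map_ofFn]
  rfl

/-- The derivative of `P` is `(m + 1) ∏ (X - β_i)` with values `P(β_1), …, P(β_m)` that are
pairwise distinct; in particular the critical points `β_i` are distinct. -/
def HasDistinctCriticalValues (m : ℕ) (P : ℂ[X]) : Prop :=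
  ∃ β : Fin m → ℂ, derivative P = C ((m : ℂ) + 1) * ∏ i, (X - C (β i)) ∧
    ∀ k j, k ≠ j → P.eval (β j) - P.eval (β k) ≠ 0

theorem natDegree_derivative_prod_X_sub_C {m : ℕ} (α : Fin (m + 1) → ℂ) :
    (derivative (∏ i, (X - C (α i)))).natDegree = m ∧
      (derivative (∏ i, (X - C (α i)))).leadingCoeff = (m : ℂ) + 1 := by
  have hmon : (∏ i, (X - C (α i))).Monic := monic_prod_X_sub_C _ _
  have hdeg : (∏ i, (X - C (α i))).natDegree = m + 1 := by simp
  have hd : (derivative (∏ i, (X - C (α i)))).natDegree = m := by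
    rw [natDegree_derivative, hdeg, Nat.add_sub_cancel]
  refine ⟨hd, ?_⟩
  have hcoeff := hmon.coeff_natDegree
  rw [hdeg] at hcoeff
  rw [leadingCoeff, hd, coeff_derivative, hcoeff, one_mul]

/-- The root vectors of the polynomials that do not have distinct critical values form a
thin set. -/
theorem isThin_not_hasDistinctCriticalValues (m : ℕ) :
    IsThin {α : Fin (m + 1) → ℂ | ¬ HasDistinctCriticalValues m (∏ i, (X - C (α i)))} := by
  refine IsThin.of_polynomial fun a ha v => ?_
  set P : ℂ[X][X] := ∏ i, (X - C (lineCoord a v i)) with hP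
  have hm0 : (m : ℂ) + 1 ≠ 0 := by exact_mod_cast Nat.succ_ne_zero m
  obtain ⟨q, hq⟩ := exists_eq_valueDiffProd_roots ℂ (m := m) P
    (C (C ((m : ℂ) + 1)⁻¹) * derivative P)
  have hPt : ∀ t : ℂ, P.map (evalRingHom t) = ∏ i, (X - C ((a + t • v) i)) := by
    intro t
    simp only [hP, Polynomial.map_prod, Polynomial.map_sub, map_X, map_C, eval_lineCoord]
  have hqt : ∀ (t : ℂ) (β : Fin m → ℂ),
      derivative (∏ i, (X - C ((a + t • v) i))) = C ((m : ℂ) + 1) * ∏ i, (X - C (β i)) →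
      q.eval t = valueDiffProd (∏ i, (X - C ((a + t • v) i))) β := by
    intro t β h
    rw [← hPt t]
    refine hq (evalRingHom t) β ?_
    rw [Polynomial.map_mul, ← derivative_map, hPt, h, map_C, coe_evalRingHom, eval_C, ← mul_assoc,
      ← C_mul, inv_mul_cancel₀ hm0, C_1, one_mul]
  refine ⟨q, ?_, fun t ht => ?_⟩
  · obtain ⟨β, hβ, hβ'⟩ := not_not.1 ha
    rw [hqt 0 β (by simpa using hβ), valueDiffProd_ne_zero_iff]
    simpa using hβ'
  · obtain ⟨hdeg, hlead⟩ := natDegree_derivative_prod_X_sub_C (a + t • v)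
    set D := derivative (∏ i, (X - C ((a + t • v) i))) with hD
    have hmon : (C ((m : ℂ) + 1)⁻¹ * D).Monic := by
      rw [Monic, leadingCoeff_mul, leadingCoeff_C, hlead, inv_mul_cancel₀ hm0]
    obtain ⟨β, hβ⟩ := exists_eq_prod_X_sub_C hmon
      (by rw [natDegree_C_mul (inv_ne_zero hm0), hdeg] : _ = m)
    have hDβ : D = C ((m : ℂ) + 1) * ∏ i, (X - C (β i)) := by
      rw [← hβ, ← mul_assoc, ← C_mul, mul_inv_cancel₀ hm0, C_1, one_mul]
    rw [hqt t β hDβ]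
    refine not_not.1 fun h => ht ⟨β, hDβ, valueDiffProd_ne_zero_iff.1 h⟩

/-- The polynomial `X ^ (m + 1) - m (m + 1) X` has simple roots, and its critical points, the
`m`-th roots of `m`, have distinct critical values. -/
theorem exists_injective_hasDistinctCriticalValues (m : ℕ) :
    ∃ α : Fin (m + 1) → ℂ, Function.Injective α ∧
      HasDistinctCriticalValues m (∏ i, (X - C (α i))) := by
  set P : ℂ[X] := X ^ (m + 1) - C ((m : ℂ) * (m + 1)) * X with hP
  set D : ℂ[X] := X ^ m - C (m : ℂ) with hD
  have hm0 : (m : ℂ) + 1 ≠ 0 := by exact_mod_cast Nat.succ_ne_zero m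
  have hder : derivative P = C ((m : ℂ) + 1) * D := by
    rw [hP, hD]
    rw [derivative_sub, derivative_X_pow, derivative_C_mul, derivative_X, Nat.add_sub_cancel]
    push_cast [C_mul, C_add, C_1]
    ring
  -- `P(β) = - m ^ 2 β` at the critical points `β`
  have hval : ∀ z, D.eval z = 0 → P.eval z = - (m : ℂ) ^ 2 * z := by
    intro z hz
    simp only [hD, eval_sub, eval_pow, eval_X, eval_C, sub_eq_zero] at hz
    simp only [hP, eval_sub, eval_pow, eval_X, eval_C, eval_mul, pow_succ, hz]
    ring
  have hDroot : ∀ z, D.eval z = 0 → (m : ℂ) ≠ 0 ∧ z ≠ 0 := by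
    intro z hz
    simp only [hD, eval_sub, eval_pow, eval_X, eval_C, sub_eq_zero] at hz
    have hm : m ≠ 0 := by rintro rfl; simp at hz
    refine ⟨by exact_mod_cast hm, ?_⟩
    rintro rfl
    rw [zero_pow hm] at hz
    exact hm (by exact_mod_cast hz.symm)
  have hDmon : D.Monic ∧ D.natDegree = m ∧ D.Separable := by
    rcases Nat.eq_zero_or_pos m with rfl | hm
    · simp [hD, Polynomial.separable_one]
    · exact ⟨monic_X_pow_sub_C _ hm.ne', natDegree_X_pow_sub_C,
        separable_X_pow_sub_C _ (by exact_mod_cast hm.ne') (by exact_mod_cast hm.ne')⟩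
  have hPdeg : P.natDegree = m + 1 ∧ P.Monic := by
    rcases Nat.eq_zero_or_pos m with rfl | hm
    · simp [hP, monic_X]
    · have hlt : (C ((m : ℂ) * (m + 1)) * X).natDegree < (X ^ (m + 1) : ℂ[X]).natDegree := by
        rw [natDegree_X_pow]
        exact lt_of_le_of_lt (natDegree_C_mul_le _ _) (by rw [natDegree_X]; omega)
      refine ⟨?_, ?_⟩
      · rw [hP, natDegree_sub_eq_left_of_natDegree_lt hlt, natDegree_X_pow]
      · exact (monic_X_pow _).sub_of_left (degree_lt_degree hlt)
  obtain ⟨α, hα⟩ := exists_eq_prod_X_sub_C hPdeg.2 hPdeg.1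
  obtain ⟨β, hβ⟩ := exists_eq_prod_X_sub_C hDmon.1 hDmon.2.1
  have hβinj : Function.Injective β := by
    rw [← separable_prod_X_sub_C_iff, ← hβ]
    exact hDmon.2.2
  have hβroot : ∀ i, D.eval (β i) = 0 := by
    intro i
    rw [hβ, eval_prod]
    exact Finset.prod_eq_zero (Finset.mem_univ i) (by simp)
  refine ⟨α, ?_, β, ?_, ?_⟩
  · rw [← separable_prod_X_sub_C_iff, ← hα, separable_def,
      isCoprime_iff_aeval_ne_zero_of_isAlgClosed ℂ ℂ]
    intro z
    simp only [coe_aeval_eq_eval]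
    refine or_iff_not_imp_right.2 fun hz => ?_
    rw [not_not, hder, eval_mul, eval_C, mul_eq_zero, or_iff_right hm0] at hz
    rw [hval z hz]
    exact mul_ne_zero (neg_ne_zero.2 (pow_ne_zero _ (hDroot z hz).1)) (hDroot z hz).2
  · rw [← hα, hder, ← hβ]
  · intro k j hkj
    rw [← hα, hval _ (hβroot j), hval _ (hβroot k), ← mul_sub]
    exact mul_ne_zero (neg_ne_zero.2 (pow_ne_zero _ (hDroot _ (hβroot j)).1))
      (sub_ne_zero.2 (hβinj.ne hkj.symm))

/-! ### The covering `F_n → C_n` and the lifting of loops -/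

theorem isOpen_injective (n : ℕ) : IsOpen {z : Fin n → ℂ | Function.Injective z} := by
  have : {z : Fin n → ℂ | Function.Injective z} =
      ⋂ i, ⋂ j, {z : Fin n → ℂ | i ≠ j → z i ≠ z j} := by
    ext z
    simp only [Set.mem_iInter, Function.Injective]
    exact forall₂_congr fun i j => not_imp_not.symm
  rw [this]
  refine isOpen_iInter_of_finite fun i => isOpen_iInter_of_finite fun j => ?_
  by_cases h : i = j
  · simp [h]
  · simpa [h] using isOpen_ne_fun (continuous_apply i) (continuous_apply j)

/-- The projection from ordered to unordered configurations is a covering map. -/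
theorem isCoveringMap_confProj (n : ℕ) : IsCoveringMap (confProj n) := by
  have : LocallyCompactSpace (OrderedConf n) := (isOpen_injective n).locallyCompactSpace
  have : ContinuousConstSMul (Equiv.Perm (Fin n)) (OrderedConf n) :=
    ⟨fun σ => continuous_induced_rng.2 (continuous_pi fun i =>
      ((continuous_apply (σ⁻¹ i)).comp continuous_subtype_val :
        Continuous fun z : OrderedConf n => z.1 (σ⁻¹ i)))⟩
  have : IsCancelSMul (Equiv.Perm (Fin n)) (OrderedConf n) := by
    refine ⟨fun σ τ z h => ?_⟩
    have h' : ∀ i, σ⁻¹ i = τ⁻¹ i := fun i => z.2 (congrFun (congrArg Subtype.val h) i)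
    exact inv_injective (Equiv.ext h')
  exact (isQuotientCoveringMap_quotientMk_of_properlyDiscontinuousSMul
    (G := Equiv.Perm (Fin n)) (E := OrderedConf n)).isCoveringMap

theorem surjective_inclusionHom_of_exists_homotopic {Y : Type*} [TopologicalSpace Y] {U : Set Y}
    (x : U) (h : ∀ γ : Path (x : Y) x, ∃ δ : Path (x : Y) x, δ.Homotopic γ ∧ ∀ t, δ t ∈ U) :
    Function.Surjective (inclusionHom U x) := by
  intro g
  obtain ⟨γ, rfl⟩ := Path.Homotopic.Quotient.mk_surjective (FundamentalGroup.toPath g)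
  obtain ⟨δ, hδ, hδU⟩ := h γ
  let δ' : Path x x := ⟨⟨fun t => ⟨δ t, hδU t⟩, by fun_prop⟩, Subtype.ext δ.source,
    Subtype.ext δ.target⟩
  refine ⟨FundamentalGroup.fromPath (Path.Homotopic.Quotient.mk δ'), ?_⟩
  exact Path.Homotopic.Quotient.eq.2 hδ

/-- Let `V` be a nonempty set of unordered configurations whose preimage in `F_n` is the trace of
the complement of a thin set. Then `V` and its preimage are path-connected, and their inclusions
are surjective on fundamental groups. -/
theorem pathConnected_and_surjective_of_isThin {n : ℕ} {V : Set (UnorderedConf n)}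
    {S : Set (Fin n → ℂ)} (hS : IsThin S)
    (hV : ∀ z : OrderedConf n, confProj n z ∈ V ↔ z.1 ∉ S) (hne : V.Nonempty) :
    (PathConnectedSpace (confProj n ⁻¹' V) ∧
      ∀ x : (confProj n ⁻¹' V : Set (OrderedConf n)),
        Function.Surjective (inclusionHom (confProj n ⁻¹' V) x)) ∧
    (PathConnectedSpace V ∧ ∀ x : V, Function.Surjective (inclusionHom V x)) := by
  have hcov := isCoveringMap_confProj n
  have hpush : ∀ {x y : OrderedConf n}, confProj n x ∈ V → confProj n y ∈ V → ∀ γ : Path x y,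
      ∃ δ : Path x y, δ.Homotopic γ ∧ ∀ t, confProj n (δ t) ∈ V := by
    intro x y hx hy γ
    obtain ⟨δ, hδ, hδS⟩ := hS.exists_homotopic_path (isOpen_injective n)
      ((hV x).1 hx) ((hV y).1 hy) γ
    exact ⟨δ, hδ, fun t => (hV _).2 (hδS t)⟩
  have hU : IsPathConnected (confProj n ⁻¹' V) := by
    rw [isPathConnected_iff]
    refine ⟨hne.preimage Quotient.mk_surjective, fun x hx y hy => ?_⟩
    obtain ⟨f, hf, hf0, hf1, hfS, -⟩ := (hS.union (isThin_not_injective n)).exists_arc (a := x.1) (b := y.1)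
      (c := 0) (r := max (dist x.1 0) (dist y.1 0) + 1)
      (by rintro (h | h); exacts [(hV x).1 hx h, h x.2])
      (by rintro (h | h); exacts [(hV y).1 hy h, h y.2])
      (lt_of_le_of_lt (le_max_left _ _) (lt_add_one _))
      (lt_of_le_of_lt (le_max_right _ _) (lt_add_one _))
    refine ⟨⟨⟨fun t => ⟨f t, not_not.1 fun h => hfS t (Or.inr h)⟩, by fun_prop⟩,
      Subtype.ext (by simpa using hf0), Subtype.ext (by simpa using hf1)⟩, fun t => ?_⟩
    exact (hV _).2 fun h => hfS t (Or.inl h)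
  have hVc : IsPathConnected V := by
    rw [← Set.image_preimage_eq V (Quotient.mk_surjective : Function.Surjective (confProj n))]
    exact hU.image hcov.continuous
  refine ⟨⟨isPathConnected_iff_pathConnectedSpace.1 hU, fun x => ?_⟩,
    isPathConnected_iff_pathConnectedSpace.1 hVc, fun x => ?_⟩
  · exact surjective_inclusionHom_of_exists_homotopic x fun γ => hpush x.2 x.2 γ
  · refine surjective_inclusionHom_of_exists_homotopic x fun γ => ?_
    obtain ⟨z, hz⟩ := Quotient.mk_surjective x.1
    change confProj n z = x.1 at hz
    have hγ0 : (γ : C(unitInterval, UnorderedConf n)) 0 = confProj n z := by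
      rw [hz]; exact γ.source
    -- The loop lifts to a path, in general not closed, between two points over the base point.
    let Γ := hcov.liftPath γ z hγ0
    have hΓ : ∀ t, confProj n (Γ t) = γ t := fun t => congrFun (hcov.liftPath_lifts γ z hγ0) t
    have hΓ1 : confProj n (Γ 1) = x.1 := by rw [hΓ, γ.target]
    let Γ' : Path z (Γ 1) := ⟨Γ, hcov.liftPath_zero γ z hγ0, rfl⟩
    obtain ⟨δ, hδ, hδV⟩ := hpush (by rw [hz]; exact x.2) (by rw [hΓ1]; exact x.2) Γ'
    refine ⟨(δ.map hcov.continuous).cast hz.symm hΓ1.symm, ?_, hδV⟩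
    have h := (hδ.map ⟨confProj n, hcov.continuous⟩).pathCast hz.symm hΓ1.symm
    have hγ : (Γ'.map hcov.continuous).cast hz.symm hΓ1.symm = γ := by
      ext t
      exact hΓ t
    rw [← hγ]
    exact h

/-! ### The spaces `QF`, `QC`, `RF`, `RC` -/

theorem mem_QF_iff {m : ℕ} (β : OrderedConf m) : β ∈ QF m ↔
    β.1 ∉ {β : Fin m → ℂ | ¬ ∀ k j : Fin m, k ≠ j →
      polyIntegral (C ((m : ℂ) + 1) * ∏ i, (X - C (β i))) (β k) (β j) ≠ 0} := by
  rw [Set.mem_ofPred_eq, not_not]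
  rfl

theorem smul_mem_QF {m : ℕ} (σ : Equiv.Perm (Fin m)) {β : OrderedConf m} (h : β ∈ QF m) :
    σ • β ∈ QF m := by
  intro k j hkj
  rw [orderedPoly_smul]
  exact h _ _ (σ⁻¹.injective.ne hkj)

theorem confProj_mem_QC_iff {m : ℕ} (β : OrderedConf m) : confProj m β ∈ QC m ↔ β ∈ QF m := by
  refine ⟨?_, fun h => ⟨β, h, rfl⟩⟩
  rintro ⟨β', h, hβ⟩
  obtain ⟨σ, rfl⟩ := Quotient.exact hβ
  rw [← inv_smul_smul σ β]
  exact smul_mem_QF σ⁻¹ h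

theorem confProj_mem_RC_iff {m : ℕ} (α : OrderedConf (m + 1)) :
    confProj (m + 1) α ∈ RC (m + 1) ↔
      HasDistinctCriticalValues m (∏ i, (X - C (α.1 i))) := by
  have hu : unorderedPoly (confProj (m + 1) α) = ∏ i, (X - C (α.1 i)) := rfl
  have hm : ((m + 1 : ℕ) : ℂ) = m + 1 := by push_cast; rfl
  constructor
  · rintro ⟨b, ⟨β, hβ, rfl⟩, hb⟩
    rw [hu, hm] at hb
    refine ⟨β.1, hb, fun k j hkj => ?_⟩
    rw [← polyIntegral_derivative, hb]
    exact hβ k j hkj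
  · rintro ⟨β, hβ, hval⟩
    have hinj : Function.Injective β := fun k j hkj =>
      by_contra fun hne => hval k j hne (by rw [hkj, sub_self])
    refine ⟨confProj m ⟨β, hinj⟩, ⟨⟨β, hinj⟩, fun k j hkj => ?_, rfl⟩, ?_⟩
    · have h := hval k j hkj
      rw [← polyIntegral_derivative, hβ] at h
      exact h
    · rw [hu, hm]
      exact hβ

theorem RC_nonempty (m : ℕ) : (RC (m + 1)).Nonempty := by
  obtain ⟨α, hα, h⟩ := exists_injective_hasDistinctCriticalValues m
  exact ⟨_, (confProj_mem_RC_iff ⟨α, hα⟩).2 h⟩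

theorem mainTheorem5 (n : ℕ) (hn : 1 ≤ n) :
    (PathConnectedSpace (QF (n - 1)) ∧
      ∀ x : QF (n - 1), Function.Surjective (inclusionHom (QF (n - 1)) x)) ∧
    (PathConnectedSpace (QC (n - 1)) ∧
      ∀ x : QC (n - 1), Function.Surjective (inclusionHom (QC (n - 1)) x)) ∧
    (PathConnectedSpace (RF n) ∧
      ∀ x : RF n, Function.Surjective (inclusionHom (RF n) x)) ∧
    (PathConnectedSpace (RC n) ∧
      ∀ x : RC n, Function.Surjective (inclusionHom (RC n) x)) := by
  obtain ⟨m, rfl⟩ := Nat.exists_eq_add_of_le' hn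
  rw [Nat.add_sub_cancel]
  have hQne : (QC m).Nonempty := by
    obtain ⟨c, b, hb, -⟩ := RC_nonempty m
    exact ⟨b, hb⟩
  have hQF : QF m = confProj m ⁻¹' QC m := Set.ext fun β => (confProj_mem_QC_iff β).symm
  have hQ := pathConnected_and_surjective_of_isThin (V := QC m) (isThin_polyIntegral_eq_zero m)
    (fun z => (confProj_mem_QC_iff z).trans (mem_QF_iff z)) hQne
  have hR := pathConnected_and_surjective_of_isThin (V := RC (m + 1))
    (isThin_not_hasDistinctCriticalValues m)
    (fun z => (confProj_mem_RC_iff z).trans not_not.symm) (RC_nonempty m)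
  rw [← hQF] at hQ
  exact ⟨hQ.1, hQ.2, hR.1, hR.2⟩
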